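/- For $K\ge 1$ consider the two-player game in which both players have the strategy set $\{1,\dots,K\}$ and in which the payoffs $Z_i^{s}$ ($i\in\{1,2\}$, $s\in\mathcal S=\{1,\dots,K\}^2$) are independent and identically distributed real random variables with a continuous (atomless) distribution. Write $s\sim_i t$ if the profiles $s,t\in\mathcal S$ differ in the strategy of player $i$ and only there. A profile $s$ is a pure Nash equilibrium if $Z_i^s\ge Z_i^t$ for all $i$ and all $t\sim_i s$. The better-response dynamics of the realized game is the Markov chain on $\mathcal S$ that, from $s$, picks a player $I\in\{1,2\}$ uniformly at random and moves to a uniformly random element of $\mathcal P^{(I)}_s=\{t\sim_I s: Z_I^t\ge Z_I^s\}$; if this set is empty, it moves to a uniformly random element of the corresponding set of the other player; and if both sets are empty, it stays at $s$. A better-response trap is a set $\tau\subset\mathcal S$ with $|\tau|\ge 2$ such that, for the dynamics $(X(n))_{n\ge0}$ started at any profile, almost surely, for all $n$: if $X(n)\in\tau$ then $X(n+1)\in\tau$, and for every $s\in\tau$ there is $k>n$ with $X(k)=s$. Let $\mathcal T$ be the collection of the traps with at least $4$ elements (almost surely, all traps have at least $4$ elements). Theorem. For every $\alpha\in(0,1)$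 there is a constant $C>0$, depending only on $\alpha$, such that for all sufficiently large $K$ (how large depending only on $\alpha$), $$\mathbb P\bigl(\mathcal T\neq\varnothing\ \text{and the game has a pure Nash equilibrium}\bigr)\ \le\ C\,K^{-3+2\alpha}+K^{2}\Bigl(\frac12\Bigr)^{K^{\alpha/2}}+K^{-K^{\alpha}}.$$ -/

import Mathlib

open MeasureTheory ProbabilityTheory

noncomputable section

namespace RandomGame

/-- Strategy profiles of the two-player game in which both players have the strategy set
`Fin K`. The two players are `0` and `1`. -/
abbrev Profile (K : ℕ) : Type := Fin 2 → Fin K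

/-- A payoff table: `z i s` is the payoff of player `i` at the profile `s`. -/
abbrev Game (K : ℕ) : Type := Fin 2 → Profile K → ℝ

variable {K : ℕ}

/-- `s ∼ᵢ t`: the two profiles differ in the strategy of player `i` and in nothing else. -/
def Neighbor (i : Fin 2) (s t : Profile K) : Prop :=
  s i ≠ t i ∧ ∀ j, j ≠ i → s j = t j

/-- Pure Nash equilibria. -/
def IsPNE (z : Game K) (s : Profile K) : Prop :=
  ∀ i t, Neighbor i s t → z i t ≤ z i s

/-- The set of all pure Nash equilibria of the game. -/
def pneSet (z : Game K) : Set (Profile K) := {s | IsPNE z s}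

open Classical in
/-- The better responses of player `i` at the profile `s`. -/
def betterResponses (z : Game K) (i : Fin 2) (s : Profile K) : Finset (Profile K) :=
  Finset.univ.filter fun t => Neighbor i s t ∧ z i s ≤ z i t

open Classical in
/-- One move of the better-response dynamics from `s` when player `i` has been picked: a
uniformly random better response of player `i`; if there is none, a uniformly random better
response of the other player; if there is none either, the profile stays put. -/
def moveOf (z : Game K) (s : Profile K) (i : Fin 2) : PMF (Profile K) :=
  if h : (betterResponses z i s).Nonempty then
    PMF.uniformOfFinset (betterResponses z i s) h
  else if h' : (betterResponses z i.rev s).Nonempty then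
    PMF.uniformOfFinset (betterResponses z i.rev s) h'
  else PMF.pure s

/-- One step of the better-response dynamics from `s`: a player is picked uniformly at random
and then moves. -/
def step (z : Game K) (s : Profile K) : PMF (Profile K) :=
  (PMF.uniformOfFintype (Fin 2)).bind (moveOf z s)

/-- The transition kernels of the better-response dynamics: given the path up to time `n`, the
law of the position at time `n + 1`. It depends on the position at time `n` only. -/
def stepKernel (z : Game K) (n : ℕ) :
    Kernel ((i : Finset.Iic n) → (fun _ : ℕ => Profile K) i) (Profile K) :=
  Kernel.ofFunOfCountable fun x => (step z (x ⟨n, Finset.mem_Iic.2 le_rfl⟩)).toMeasure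

instance (z : Game K) (n : ℕ) : IsMarkovKernel (stepKernel z n) :=
  ⟨fun x => by
    change IsProbabilityMeasure (step z (x ⟨n, Finset.mem_Iic.2 le_rfl⟩)).toMeasure
    infer_instance⟩

/-- The law, on the space of paths `ℕ → Profile K`, of the better-response dynamics of the game
`z` started at the profile `s₀`. -/
def bRD (z : Game K) (s₀ : Profile K) : Measure (ℕ → Profile K) :=
  Kernel.traj (X := fun _ : ℕ => Profile K) (stepKernel z) 0 fun _ => s₀

/-- Traps of the better-response dynamics: sets of at least two profiles such that, from whatever
profile `s₀` the dynamics is started, almost surely, whenever it is in the set at some time `n`,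
it is still there at time `n + 1`, and it visits every profile of the set at some time
after `n`. -/
def IsTrap (z : Game K) (τ : Finset (Profile K)) : Prop :=
  2 ≤ τ.card ∧
  (∀ (s₀ : Profile K) (n : ℕ), ∀ᵐ X ∂(bRD z s₀), X n ∈ τ → X (n + 1) ∈ τ) ∧
  (∀ s ∈ τ, ∀ (s₀ : Profile K) (n : ℕ), ∀ᵐ X ∂(bRD z s₀), X n ∈ τ → ∃ k, n < k ∧ X k = s)

/-- The collection of traps with exactly `n` profiles. -/
def trapsOfLength (z : Game K) (n : ℕ) : Set (Finset (Profile K)) :=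
  {τ | IsTrap z τ ∧ τ.card = n}

/-- The collection of all traps. -/
def traps (z : Game K) : Set (Finset (Profile K)) :=
  ⋃ n ∈ Set.Icc 4 (K ^ 2), trapsOfLength z n

end RandomGame

end

/-!
A trap `τ` is closed under better responses. Hence, on each line of the board (the profiles that
differ in the strategy of one player `i` only), the profiles of `τ` have strictly larger payoffs for
player `i` than all the others on the line. If `m` profiles of a given line lie in `τ`, this has
probability `1 / choose K m`, and different lines are independent.

In the absence of ties, a pure Nash equilibrium belongs to no trap, and neither does any profile on
the two lines through it. So a trap that coexists with an equilibrium misses a strategy of each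
player: the numbers `r` and `c` of strategies used in `τ` are at most `K - 1`. Let `L` be the integer
part of `K ^ (α / 4)`.

* Suppose that `r` or `c` exceeds `L`. Sum the probability over all sets `τ` with prescribed sets of
  rows and columns. By the Cauchy-Schwarz inequality, the two players separate, and for each of them
  the sum factorizes over the lines (`sum_prod_inv_choose_sq_le`); a line contributes at most
  `6 r / K ^ 2`, because `r < K` (`sum_inv_choose_sq_le`). Multiplied with the number
  `choose K r * choose K c` of choices of rows and columns, the bound decays geometrically in
  `r + c`, thanks to the factorials (`choose_sq_mul_pow_le`). Altogether this gives a bound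
  exponentially small in `K ^ (α / 4)` (`measureReal_large_le`).

* Suppose that `r` and `c` are at most `L`. Then each profile of `τ` is among the `L` best on both
  of its lines. Traps are irreducible, hence connected, so `τ` contains a connected set of four
  profiles (`IsTrap.exists_cluster`). There are at most `48 K ^ 5` of these, and each of them consists
  of profiles among the `L` best with probability at most `(L / K) ^ 8`. This yields the main term
  `48 K ^ (-3 + 2 α)` (`measureReal_small_le`).

The probabilities on a single line follow from exchangeability alone (`measureReal_le_div_choose`);
that the payoffs are atomless is needed only to exclude ties.
-/

namespace RandomGame

/-! ### The dynamics and its traps -/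

section Dynamics

variable {K : ℕ}

lemma eq_or_eq_rev (i j : Fin 2) : j = i ∨ j = i.rev := by
  revert i j; decide

lemma mem_betterResponses {z : Game K} {i : Fin 2} {s t : Profile K} :
    t ∈ betterResponses z i s ↔ Neighbor i s t ∧ z i s ≤ z i t := by
  simp [betterResponses]

lemma mem_support_step_of_mem_betterResponses {z : Game K} {i : Fin 2} {s t : Profile K}
    (h : t ∈ betterResponses z i s) : t ∈ (step z s).support := by
  rw [step, PMF.mem_support_bind_iff]
  refine ⟨i, by simp, ?_⟩
  have hne : (betterResponses z i s).Nonempty := ⟨t, h⟩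
  rw [moveOf, dif_pos hne]
  exact (PMF.mem_support_uniformOfFinset_iff hne t).2 h

lemma eq_or_mem_betterResponses_of_mem_support_step {z : Game K} {s t : Profile K}
    (h : t ∈ (step z s).support) : t = s ∨ ∃ i, t ∈ betterResponses z i s := by
  rw [step, PMF.mem_support_bind_iff] at h
  obtain ⟨i, -, hi⟩ := h
  rw [moveOf] at hi
  split_ifs at hi with h1 h2
  · exact Or.inr ⟨i, (PMF.mem_support_uniformOfFinset_iff h1 t).1 hi⟩
  · exact Or.inr ⟨i.rev, (PMF.mem_support_uniformOfFinset_iff h2 t).1 hi⟩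
  · exact Or.inl (by simpa using hi)

lemma ae_traj_stepKernel_self (z : Game K) (n : ℕ)
    (x : (i : Finset.Iic n) → (fun _ : ℕ => Profile K) i) :
    ∀ᵐ X ∂(Kernel.traj (X := fun _ : ℕ => Profile K) (stepKernel z) n x),
      X n = x ⟨n, Finset.mem_Iic.2 le_rfl⟩ := by
  have h : (Kernel.traj (X := fun _ : ℕ => Profile K) (stepKernel z) n x).map
      (Preorder.frestrictLe n) = Measure.dirac x := by
    rw [Kernel.traj_map_frestrictLe_apply, Kernel.partialTraj_self, Kernel.id_apply]
  have h2 : ∀ᵐ y ∂((Kernel.traj (X := fun _ : ℕ => Profile K) (stepKernel z) n x).map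
      (Preorder.frestrictLe n)), y = x := by
    rw [h]
    exact (ae_dirac_iff (by measurability)).2 rfl
  filter_upwards [ae_of_ae_map (by fun_prop) h2] with X hX
  rw [← hX]
  rfl

lemma traj_stepKernel_map_succ (z : Game K) (n : ℕ)
    (x : (i : Finset.Iic n) → (fun _ : ℕ => Profile K) i) :
    (Kernel.traj (X := fun _ : ℕ => Profile K) (stepKernel z) n x).map (fun X => X (n + 1)) =
      (step z (x ⟨n, Finset.mem_Iic.2 le_rfl⟩)).toMeasure := by
  rw [← Kernel.map_apply _ (by fun_prop), Kernel.map_traj_succ_self]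
  rfl

lemma ae_bRD_zero (z : Game K) (s₀ : Profile K) : ∀ᵐ X ∂(bRD z s₀), X 0 = s₀ :=
  ae_traj_stepKernel_self z 0 _

/-- Almost surely, each step of the dynamics is one that the transition law allows. -/
lemma ae_bRD_succ (z : Game K) (s₀ : Profile K) (n : ℕ) :
    ∀ᵐ X ∂(bRD z s₀), X (n + 1) ∈ (step z (X n)).support := by
  rw [bRD, ← Kernel.traj_comp_partialTraj (Nat.zero_le n), Kernel.comp_apply]
  refine Measure.ae_comp_of_ae_ae (by measurability) (ae_of_all _ fun x => ?_)
  have h1 := ae_traj_stepKernel_self z n x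
  have h2 : ∀ᵐ t ∂((Kernel.traj (X := fun _ : ℕ => Profile K) (stepKernel z) n x).map
      (fun X => X (n + 1))), t ∈ (step z (x ⟨n, Finset.mem_Iic.2 le_rfl⟩)).support := by
    rw [traj_stepKernel_map_succ, ae_iff, PMF.toMeasure_apply_eq_zero_iff _ (by measurability)]
    exact Set.disjoint_left.2 fun t ht ht' => ht' ht
  filter_upwards [h1, ae_of_ae_map (measurable_pi_apply _).aemeasurable h2] with X hX hX2
  rwa [hX]

lemma ae_ne_of_mem_support {z : Game K} {s t : Profile K} (h : t ∈ (step z s).support) :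
    ¬ ∀ᵐ X ∂(bRD z s), X 1 ≠ t := by
  intro h'
  have h1 := traj_stepKernel_map_succ z 0 (fun _ => s)
  have h2 : ∀ᵐ u ∂((bRD z s).map (fun X => X 1)), u ≠ t :=
    (ae_map_iff (measurable_pi_apply 1).aemeasurable (by measurability)).2 h'
  rw [bRD, h1, ae_iff, PMF.toMeasure_apply_eq_zero_iff _ (by measurability)] at h2
  exact Set.disjoint_left.1 h2 h (by simp)

/-- Traps are closed under better responses. -/
lemma IsTrap.mem_of_mem_betterResponses {z : Game K} {τ : Finset (Profile K)} (h : IsTrap z τ)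
    {i : Fin 2} {s t : Profile K} (hs : s ∈ τ) (ht : t ∈ betterResponses z i s) : t ∈ τ := by
  by_contra hτ
  refine ae_ne_of_mem_support (mem_support_step_of_mem_betterResponses ht) ?_
  filter_upwards [ae_bRD_zero z s, h.2.1 s 0] with X h0 h1 ht'
  exact hτ (ht' ▸ h1 (h0 ▸ hs))

/-- Traps are irreducible: a set that meets the trap and is closed under better responses
contains the trap. -/
lemma IsTrap.subset_of_closed {z : Game K} {τ : Finset (Profile K)} (h : IsTrap z τ)
    {A : Set (Profile K)} {s₀ : Profile K} (hs₀ : s₀ ∈ τ) (hA₀ : s₀ ∈ A)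
    (hA : ∀ s ∈ A, ∀ i, ∀ t ∈ betterResponses z i s, t ∈ A) {s : Profile K} (hs : s ∈ τ) :
    s ∈ A := by
  have hprob : IsProbabilityMeasure (bRD z s₀) := by
    unfold bRD; infer_instance
  obtain ⟨X, h0, hX, hk⟩ := ((ae_bRD_zero z s₀).and ((ae_all_iff.2 (ae_bRD_succ z s₀)).and
    (h.2.2 s hs s₀ 0))).exists
  have hmem : ∀ n, X n ∈ A := by
    intro n
    induction n with
    | zero => exact h0 ▸ hA₀
    | succ n ih =>
      rcases eq_or_mem_betterResponses_of_mem_support_step (hX n) with h | ⟨i, h⟩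
      · exact h ▸ ih
      · exact hA _ ih i _ h
  obtain ⟨k, -, hk⟩ := hk (h0 ▸ hs₀)
  exact hk ▸ hmem k

/-- A proper nonempty part of a trap has a neighbor in the rest of the trap. -/
lemma IsTrap.exists_neighbor {z : Game K} {τ : Finset (Profile K)} (h : IsTrap z τ)
    {A : Finset (Profile K)} (hA : A ⊆ τ) (hne : A.Nonempty) (hcard : A.card < τ.card) :
    ∃ s ∈ A, ∃ i, ∃ t ∈ τ, t ∉ A ∧ Neighbor i s t := by
  by_contra! hcon
  obtain ⟨s₀, hs₀⟩ := hne
  have : τ ⊆ A := fun s hs =>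
    h.subset_of_closed (A := (A : Set (Profile K))) (hA hs₀) hs₀ (fun s hs i t ht => by
      by_contra htA
      exact hcon s hs i t (h.mem_of_mem_betterResponses (hA hs) ht) htA
        (mem_betterResponses.1 ht).1) hs
  exact absurd (Finset.card_le_card this) (by omega)

/-- In a game without ties, a trap contains no profile that agrees with a pure Nash equilibrium
in the strategy of some player. -/
lemma IsTrap.ne_of_isPNE {z : Game K} {τ : Finset (Profile K)} (h : IsTrap z τ)
    (hz : ∀ i s t, s ≠ t → z i s ≠ z i t) {e s : Profile K} (he : IsPNE z e) (hs : s ∈ τ)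
    (i : Fin 2) : s i ≠ e i := by
  -- Without ties, a pure Nash equilibrium is absorbing, and a trap has at least two profiles.
  have heτ : e ∉ τ := by
    intro heτ
    have : τ ⊆ {e} := fun s hs => by
      have := h.subset_of_closed (A := {e}) heτ rfl (fun s hs i t ht => by
        rw [Set.mem_singleton_iff] at hs
        subst hs
        obtain ⟨h1, h2⟩ := mem_betterResponses.1 ht
        exact absurd (le_antisymm h2 (he i t h1)) (hz i _ _ fun h => h1.1 (h ▸ rfl))) hs
      simpa using this
    have := Finset.card_le_card this
    have := h.1
    simp at *
    omega
  intro hi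
  by_cases hj : s i.rev = e i.rev
  · have : s = e := by
      ext j
      rcases eq_or_eq_rev i j with rfl | rfl <;> simp [*]
    exact heτ (this ▸ hs)
  -- Otherwise, the equilibrium is a better response at `s` of the player other than `i`.
  · have key : ∀ j, j ≠ i.rev → j = i := fun j hj => (eq_or_eq_rev i j).resolve_right hj
    refine heτ (h.mem_of_mem_betterResponses (i := i.rev) hs (mem_betterResponses.2 ⟨⟨hj, ?_⟩, ?_⟩))
    · intro j hj; rw [key j hj, hi]
    · refine he _ _ ⟨Ne.symm hj, ?_⟩
      intro j hj; rw [key j hj, hi]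

end Dynamics

/-! ### Exchangeable and independent payoffs -/

section Exchangeable

variable {κ : Type*} [Fintype κ] [DecidableEq κ]

lemma exists_perm_map_eq {J J' : Finset κ} (h : J.card = J'.card) :
    ∃ σ : Equiv.Perm κ, J.map σ.toEmbedding = J' := by
  let e : {x // x ∈ J} ≃ {x // x ∈ J'} := Finset.equivOfCardEq h
  refine ⟨e.extendSubtype, Finset.eq_of_subset_of_card_le ?_ (by simp [h])⟩
  intro y hy
  obtain ⟨x, hx, rfl⟩ := Finset.mem_map.1 hy
  exact e.extendSubtype_mem x hx

/-- Let the events `U J`, indexed by the finite sets `J`, be permuted among themselves by the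
permutations of the coordinates. If no point lies in more than `B` of the events with `#J = j`,
then each of these has probability at most `B / choose #κ j` under an i.i.d. law. -/
lemma measureReal_le_div_choose (ν : Measure ℝ) [IsProbabilityMeasure ν]
    (U : Finset κ → Set (κ → ℝ)) (hU : ∀ J, MeasurableSet (U J))
    (hequiv : ∀ (σ : Equiv.Perm κ) J w, w ∘ σ ∈ U J ↔ w ∈ U (J.map σ.toEmbedding))
    (B : ℕ) (J : Finset κ)
    (hB : ∀ w, ∀ 𝒥 : Finset (Finset κ), (∀ I ∈ 𝒥, I.card = J.card ∧ w ∈ U I) → 𝒥.card ≤ B) :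
    (Measure.pi fun _ : κ => ν).real (U J) ≤ B / (Fintype.card κ).choose J.card := by
  classical
  set μ := Measure.pi fun _ : κ => ν
  have hinv : ∀ I ∈ Finset.powersetCard J.card Finset.univ, μ (U I) = μ (U J) := by
    intro I hI
    obtain ⟨σ, rfl⟩ := exists_perm_map_eq (Finset.mem_powersetCard.1 hI).2.symm
    have hσ := measurePreserving_piCongrLeft (fun _ : κ => ν) σ.symm
    have hset : (MeasurableEquiv.piCongrLeft (fun _ : κ => ℝ) σ.symm) ⁻¹' (U J) =
        U (J.map σ.toEmbedding) := by
      ext w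
      rw [← hequiv, Set.mem_preimage]
      have : MeasurableEquiv.piCongrLeft (fun _ : κ => ℝ) σ.symm w = w ∘ σ := by
        ext x
        have := MeasurableEquiv.piCongrLeft_apply_apply (β := fun _ : κ => ℝ) σ.symm w (σ x)
        rwa [Equiv.symm_apply_apply] at this
      rw [this]
    rw [← hset]
    exact hσ.measure_preimage (hU J).nullMeasurableSet
  have hsum : ∑ I ∈ Finset.powersetCard J.card Finset.univ, μ (U I) ≤ B := by
    calc ∑ I ∈ Finset.powersetCard J.card Finset.univ, μ (U I)
        = ∫⁻ w, ∑ I ∈ Finset.powersetCard J.card Finset.univ, (U I).indicator 1 w ∂μ := by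
          rw [lintegral_finsetSum]
          · exact Finset.sum_congr rfl fun I _ => (lintegral_indicator_one (hU I)).symm
          · exact fun I _ => measurable_one.indicator (hU I)
      _ ≤ ∫⁻ _, (B : ENNReal) ∂μ := by
          refine lintegral_mono fun w => ?_
          simp only [Set.indicator_apply, Pi.one_apply]
          rw [Finset.sum_boole]
          refine Nat.cast_le.2 (hB w _ fun I hI => ?_)
          simpa using hI
      _ = B := by simp
  rw [Finset.sum_congr rfl hinv, Finset.sum_const, Finset.card_powersetCard, Finset.card_univ,
    nsmul_eq_mul] at hsum
  have hpos : 0 < (Fintype.card κ).choose J.card := Nat.choose_pos J.card_le_univ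
  rw [le_div_iff₀ (by exact_mod_cast hpos), mul_comm]
  have := ENNReal.toReal_mono (by simp) hsum
  simpa [measureReal_def] using this

/-- The vectors for which the coordinates in `J` are strictly larger than all the others. -/
def topSet (J : Finset κ) : Set (κ → ℝ) := {w | ∀ x ∈ J, ∀ y ∉ J, w y < w x}

/-- The vectors for which each coordinate in `J` is among the `L` largest: at most `L` coordinates,
itself included, are at least as large. -/
def topRank (L : ℕ) (J : Finset κ) : Set (κ → ℝ) :=
  {w | ∀ x ∈ J, (Finset.univ.filter fun y => w x ≤ w y).card ≤ L}

omit [Fintype κ] [DecidableEq κ] in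
lemma measurableSet_topSet [Countable κ] (J : Finset κ) : MeasurableSet (topSet J) := by
  simp only [topSet, Set.ofPred_forall]
  refine MeasurableSet.iInter fun x => .iInter fun _ => .iInter fun y => .iInter fun _ => ?_
  exact measurableSet_lt (measurable_pi_apply y) (measurable_pi_apply x)

omit [DecidableEq κ] in
lemma measurableSet_topRank (L : ℕ) (J : Finset κ) : MeasurableSet (topRank L J) := by
  simp only [topRank, Set.ofPred_forall]
  refine MeasurableSet.iInter fun x => .iInter fun _ => ?_
  simp only [Finset.card_filter]
  refine measurableSet_le (Finset.measurable_fun_sum _ fun y _ => ?_) measurable_const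
  exact Measurable.ite (measurableSet_le (measurable_pi_apply x) (measurable_pi_apply y))
    measurable_const measurable_const

/-- Two different sets of the same size cannot both consist of the largest coordinates, so the sets
of a given size are equally likely to do so and exclude one another. -/
lemma measureReal_topSet_le (ν : Measure ℝ) [IsProbabilityMeasure ν] (J : Finset κ) :
    (Measure.pi fun _ : κ => ν).real (topSet J) ≤ 1 / (Fintype.card κ).choose J.card := by
  refine (measureReal_le_div_choose ν topSet measurableSet_topSet ?_ 1 J ?_).trans_eq (by simp)
  · intro σ J w
    simp only [topSet, Set.mem_ofPred_eq, Finset.forall_mem_map, Function.comp_apply,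
      Equiv.coe_toEmbedding]
    refine forall₂_congr fun x _ => ?_
    rw [σ.forall_congr_left]
    simp [Finset.mem_map_equiv]
  · intro w 𝒥 h𝒥
    refine Finset.card_le_one.2 fun I hI I' hI' => ?_
    by_contra hne
    obtain ⟨h1, h2⟩ := h𝒥 I hI
    obtain ⟨h1', h2'⟩ := h𝒥 I' hI'
    obtain ⟨x, hx, hx'⟩ := Finset.not_subset.1 fun h =>
      hne (Finset.eq_of_subset_of_card_le h (by omega))
    obtain ⟨y, hy, hy'⟩ := Finset.not_subset.1 fun h =>
      hne (Finset.eq_of_subset_of_card_le h (by omega)).symm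
    exact lt_asymm (h2 x hx y hy') (h2' y hy x hx')

lemma choose_div_choose_le_pow {L K : ℕ} (hL : L ≤ K) (hK : 0 < K) (j : ℕ) (hj : j ≤ K) :
    (L.choose j : ℝ) / K.choose j ≤ ((L : ℝ) / K) ^ j := by
  induction j with
  | zero => simp
  | succ j ih =>
    have h1 : (L.choose (j + 1) : ℝ) * (j + 1) = L.choose j * ((L : ℝ) - j) := by
      rcases le_or_gt j L with h | h
      · rw [← Nat.cast_sub h]; exact_mod_cast Nat.choose_succ_right_eq L j
      · simp [Nat.choose_eq_zero_of_lt h, Nat.choose_eq_zero_of_lt (Nat.lt_succ_of_lt h)]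
    have h2 : (K.choose (j + 1) : ℝ) * (j + 1) = K.choose j * ((K : ℝ) - j) := by
      rw [← Nat.cast_sub (by omega : j ≤ K)]; exact_mod_cast Nat.choose_succ_right_eq K j
    have hKj : (0 : ℝ) < (K : ℝ) - j := by
      have : ((j + 1 : ℕ) : ℝ) ≤ K := by exact_mod_cast hj
      push_cast at this; linarith
    have hK' : (0 : ℝ) < K := by exact_mod_cast hK
    have hL' : (L : ℝ) ≤ K := by exact_mod_cast hL
    have e : (L.choose (j + 1) : ℝ) / K.choose (j + 1) =
        (L.choose j : ℝ) / K.choose j * (((L : ℝ) - j) / (K - j)) := by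
      have hj1 : (j + 1 : ℝ) ≠ 0 := by positivity
      rw [← mul_div_mul_right _ _ hj1, h1, h2, mul_div_mul_comm]
    rw [e, pow_succ]
    have h3 : ((L : ℝ) - j) / (K - j) ≤ (L : ℝ) / K := by
      rw [div_le_div_iff₀ hKj hK']
      nlinarith [mul_nonneg (Nat.cast_nonneg (α := ℝ) j) (sub_nonneg.2 hL')]
    calc (L.choose j : ℝ) / K.choose j * (((L : ℝ) - j) / (K - j))
        ≤ (L.choose j : ℝ) / K.choose j * ((L : ℝ) / K) := by gcongr
      _ ≤ _ := by
        gcongr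
        exact ih (by omega)

/-- At most `L` coordinates have rank at most `L`, so that at most `choose L j` sets of size `j`
consist of such coordinates. -/
lemma measureReal_topRank_le (ν : Measure ℝ) [IsProbabilityMeasure ν] {L : ℕ}
    (hL : L ≤ Fintype.card κ) (hκ : 0 < Fintype.card κ) (J : Finset κ) :
    (Measure.pi fun _ : κ => ν).real (topRank L J) ≤ ((L : ℝ) / Fintype.card κ) ^ J.card := by
  refine (measureReal_le_div_choose ν (topRank L) (measurableSet_topRank L) ?_
    (L.choose J.card) J ?_).trans (choose_div_choose_le_pow hL hκ _ J.card_le_univ)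
  · intro σ J w
    simp only [topRank, Set.mem_ofPred_eq, Finset.forall_mem_map, Function.comp_apply,
      Equiv.coe_toEmbedding]
    refine forall₂_congr fun x _ => ?_
    rw [← Finset.card_map σ.toEmbedding]
    congr! 2
    ext y
    simp [Finset.mem_map_equiv]
  · intro w 𝒥 h𝒥
    -- the set of all coordinates of rank at most `L`
    set T : Finset κ := Finset.univ.filter fun x =>
      (Finset.univ.filter fun y => w x ≤ w y).card ≤ L
    have hT : T.card ≤ L := by
      rcases T.eq_empty_or_nonempty with h | h
      · simp [h]
      obtain ⟨x, hx, hmin⟩ := T.exists_min_image w h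
      exact (Finset.card_le_card fun y hy => by simpa using hmin y hy).trans
        (Finset.mem_filter.1 hx).2
    calc 𝒥.card ≤ (T.powersetCard J.card).card := Finset.card_le_card fun I hI => by
          rw [Finset.mem_powersetCard]
          refine ⟨fun x hx => ?_, (h𝒥 I hI).1⟩
          simpa [T] using (h𝒥 I hI).2 x hx
      _ = T.card.choose J.card := Finset.card_powersetCard _ _
      _ ≤ L.choose J.card := Nat.choose_le_choose _ hT

end Exchangeable

section Independence

/-- The rows of an i.i.d. array are independent, and i.i.d. themselves. -/
lemma measureReal_forall_row {Ω ι κ : Type*} [MeasurableSpace Ω] {P : Measure Ω}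
    [IsProbabilityMeasure P] [Fintype ι] [Fintype κ] (ν : Measure ℝ) [IsProbabilityMeasure ν]
    (f : ι → κ → Ω → ℝ) (hf : ∀ i x, Measurable (f i x)) (hlaw : ∀ i x, P.map (f i x) = ν)
    (hind : iIndepFun (fun p : ι × κ => f p.1 p.2) P) (U : ι → Set (κ → ℝ))
    (hU : ∀ i, MeasurableSet (U i)) :
    P.real {ω | ∀ i, (fun x => f i x ω) ∈ U i} = ∏ i, (Measure.pi fun _ : κ => ν).real (U i) := by
  have h1 := hind.map_fun_eq_pi_map fun p : ι × κ => (hf p.1 p.2).aemeasurable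
  simp only [hlaw] at h1
  have h2 := Measure.infinitePi_map_curry (fun (_ : ι) (_ : κ) => ν)
  simp only [Measure.infinitePi_eq_pi] at h2
  have hm : Measurable fun ω (p : ι × κ) => f p.1 p.2 ω :=
    measurable_pi_lambda _ fun p => hf p.1 p.2
  rw [← h1, Measure.map_map (MeasurableEquiv.measurable _) hm] at h2
  have h3 : {ω | ∀ i, (fun x => f i x ω) ∈ U i} =
      ((MeasurableEquiv.curry ι κ ℝ) ∘ fun ω (p : ι × κ) => f p.1 p.2 ω) ⁻¹' Set.univ.pi U := by
    ext ω
    simp only [Set.mem_ofPred_eq, Set.mem_preimage, Set.mem_univ_pi]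
    rfl
  rw [h3, measureReal_def, ← Measure.map_apply ((MeasurableEquiv.measurable _).comp hm)
    (MeasurableSet.univ_pi hU), h2, Measure.pi_pi, ENNReal.toReal_prod]
  rfl

lemma ae_ne_of_indepFun {Ω : Type*} [MeasurableSpace Ω] {P : Measure Ω}
    [IsProbabilityMeasure P] {ν : Measure ℝ} [IsProbabilityMeasure ν] (hν : ∀ x, ν {x} = 0)
    {X Y : Ω → ℝ} (hX : Measurable X) (hY : Measurable Y) (hXν : P.map X = ν) (hYν : P.map Y = ν)
    (h : IndepFun X Y P) : ∀ᵐ ω ∂P, X ω ≠ Y ω := by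
  have h1 := (indepFun_iff_map_prod_eq_prod_map_map hX.aemeasurable hY.aemeasurable).1 h
  rw [hXν, hYν] at h1
  have hm : MeasurableSet {p : ℝ × ℝ | p.1 = p.2} := measurableSet_eq_fun measurable_fst
    measurable_snd
  have h2 : ∀ᵐ p ∂(P.map fun ω => (X ω, Y ω)), p.1 ≠ p.2 := by
    rw [h1, ae_iff]
    simp only [ne_eq, not_not]
    rw [Measure.measure_prod_null hm]
    refine ae_of_all _ fun x => ?_
    have : Prod.mk x ⁻¹' {p : ℝ × ℝ | p.1 = p.2} = {x} := by ext y; simp [eq_comm]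
    simp [this, hν]
  exact ae_of_ae_map (hX.prodMk hY).aemeasurable h2

end Independence

/-! ### Traces of traps on lines, and clusters -/

section Lines

variable {K : ℕ}

/-- The profile in which player `i` plays `x` and the other player plays `y`. As `x` varies, these
profiles form a line of the board, labelled by `(i, y)`. -/
def linePoint (i : Fin 2) (y x : Fin K) : Profile K := fun j => if j = i then x else y

lemma linePoint_self (i : Fin 2) (y x : Fin K) : linePoint i y x i = x := by
  simp [linePoint]

lemma linePoint_rev (i : Fin 2) (y x : Fin K) : linePoint i y x i.rev = y := by
  have : i.rev ≠ i := by revert i; decide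
  simp [linePoint, this]

lemma linePoint_of_profile (i : Fin 2) (s : Profile K) : linePoint i (s i.rev) (s i) = s := by
  ext j
  have : i.rev ≠ i := by revert i; decide
  rcases eq_or_eq_rev i j with rfl | rfl <;> simp [linePoint, this]

/-- The trace of a set of profiles on the line labelled by `ℓ`. -/
def lineTrace (A : Finset (Profile K)) (ℓ : Fin 2 × Fin K) : Finset (Fin K) :=
  Finset.univ.filter fun x => linePoint ℓ.1 ℓ.2 x ∈ A

lemma mem_lineTrace {A : Finset (Profile K)} {ℓ : Fin 2 × Fin K} {x : Fin K} :
    x ∈ lineTrace A ℓ ↔ linePoint ℓ.1 ℓ.2 x ∈ A := by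
  simp [lineTrace]

lemma sum_card_lineTrace (A : Finset (Profile K)) (i : Fin 2) :
    ∑ y, (lineTrace A (i, y)).card = A.card := by
  rw [Finset.card_eq_sum_card_fiberwise (f := fun s => s i.rev) (t := Finset.univ) (by simp)]
  refine Finset.sum_congr rfl fun y _ => ?_
  refine Finset.card_bij' (fun x _ => linePoint i y x) (fun s _ => s i) ?_ ?_ ?_ ?_
  · intro x hx
    simpa [linePoint_rev] using mem_lineTrace.1 hx
  · intro s hs
    obtain ⟨h1, rfl⟩ := Finset.mem_filter.1 hs
    rw [mem_lineTrace, linePoint_of_profile]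
    exact h1
  · intro x _
    exact linePoint_self i y x
  · intro s hs
    obtain ⟨h1, rfl⟩ := Finset.mem_filter.1 hs
    exact linePoint_of_profile i s

/-- The strategies of player `i` that occur in a set of profiles. -/
def shadow (A : Finset (Profile K)) (i : Fin 2) : Finset (Fin K) := A.image fun s => s i

lemma lineTrace_subset_shadow (A : Finset (Profile K)) (i : Fin 2) (y : Fin K) :
    lineTrace A (i, y) ⊆ shadow A i := fun x hx =>
  Finset.mem_image.2 ⟨_, mem_lineTrace.1 hx, linePoint_self i y x⟩

lemma lineTrace_nonempty_iff (A : Finset (Profile K)) (i : Fin 2) (y : Fin K) :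
    (lineTrace A (i, y)).Nonempty ↔ y ∈ shadow A i.rev := by
  constructor
  · rintro ⟨x, hx⟩
    exact Finset.mem_image.2 ⟨_, mem_lineTrace.1 hx, linePoint_rev i y x⟩
  · intro hy
    obtain ⟨s, hs, rfl⟩ := Finset.mem_image.1 hy
    exact ⟨s i, mem_lineTrace.2 ((linePoint_of_profile i s).symm ▸ hs)⟩

lemma lineTrace_injective (i : Fin 2) :
    Function.Injective fun (A : Finset (Profile K)) (y : Fin K) => lineTrace A (i, y) := by
  intro A B h
  ext s
  have h' : lineTrace A (i, s i.rev) = lineTrace B (i, s i.rev) := congrFun h (s i.rev)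
  rw [← linePoint_of_profile i s]
  exact (mem_lineTrace (A := A) (ℓ := (i, s i.rev))).symm.trans (h' ▸ mem_lineTrace)

/-- On each line, the profiles of a trap are strictly better than those outside of it, for the
player who can move along the line. -/
lemma IsTrap.mem_topSet {z : Game K} {τ : Finset (Profile K)} (h : IsTrap z τ)
    (ℓ : Fin 2 × Fin K) : (fun x => z ℓ.1 (linePoint ℓ.1 ℓ.2 x)) ∈ topSet (lineTrace τ ℓ) := by
  intro x hx y hy
  rw [mem_lineTrace] at hx hy
  by_contra! hle
  refine hy (h.mem_of_mem_betterResponses (i := ℓ.1) hx (mem_betterResponses.2 ⟨⟨?_, ?_⟩, hle⟩))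
  · rw [linePoint_self, linePoint_self]
    rintro rfl
    exact hy hx
  · intro j hj
    simp [linePoint, hj]

/-- If each player uses at most `L` strategies in a trap, then each profile of the trap is among
the `L` best on both of its lines. -/
lemma IsTrap.mem_topRank {z : Game K} {τ : Finset (Profile K)} (h : IsTrap z τ) {L : ℕ}
    (hL : ∀ i, (shadow τ i).card ≤ L) {A : Finset (Profile K)} (hA : A ⊆ τ)
    (ℓ : Fin 2 × Fin K) : (fun x => z ℓ.1 (linePoint ℓ.1 ℓ.2 x)) ∈ topRank L (lineTrace A ℓ) := by
  intro x hx
  refine (Finset.card_le_card fun y hy => ?_).trans (hL ℓ.1)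
  refine lineTrace_subset_shadow τ ℓ.1 ℓ.2 ?_
  by_contra hy'
  have hx' : x ∈ lineTrace τ ℓ := mem_lineTrace.2 (hA (mem_lineTrace.1 hx))
  exact absurd (Finset.mem_filter.1 hy).2 (not_le.2 (h.mem_topSet ℓ x hx' y hy'))

/-- In the presence of a pure Nash equilibrium, a trap misses a strategy of each player. -/
lemma IsTrap.card_shadow_lt {z : Game K} {τ : Finset (Profile K)} (h : IsTrap z τ)
    (hz : ∀ i s t, s ≠ t → z i s ≠ z i t) {e : Profile K} (he : IsPNE z e) (i : Fin 2) :
    (shadow τ i).card < K := by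
  have hmem : e i ∉ shadow τ i := fun hu => by
    obtain ⟨s, hs, hse⟩ := Finset.mem_image.1 hu
    exact h.ne_of_isPNE hz he hs i hse
  simpa using Finset.card_lt_univ_of_notMem hmem

end Lines

section Clusters

variable {K : ℕ}

/-- The sets of profiles that are built from a single profile by adding, `n` times, a profile that
arises from one already present by changing the strategy of one player. -/
def clusters (K : ℕ) : ℕ → Finset (Finset (Profile K))
  | 0 => Finset.univ.image fun s => {s}
  | n + 1 => (clusters K n).biUnion fun A =>
      (A ×ˢ (Finset.univ : Finset (Fin 2 × Fin K))).image fun p =>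
        insert (Function.update p.1 p.2.1 p.2.2) A

lemma card_le_of_mem_clusters {n : ℕ} {A : Finset (Profile K)} (hA : A ∈ clusters K n) :
    A.card ≤ n + 1 := by
  induction n generalizing A with
  | zero =>
    obtain ⟨s, -, rfl⟩ := Finset.mem_image.1 hA
    simp
  | succ n ih =>
    obtain ⟨A', hA', hA⟩ := Finset.mem_biUnion.1 hA
    obtain ⟨p, -, rfl⟩ := Finset.mem_image.1 hA
    exact (Finset.card_insert_le _ _).trans (Nat.succ_le_succ (ih hA'))

lemma card_clusters_le (K n : ℕ) :
    (clusters K n).card ≤ K ^ 2 * (2 * K) ^ n * n.factorial := by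
  induction n with
  | zero =>
    refine Finset.card_image_le.trans ?_
    simp
  | succ n ih =>
    calc (clusters K (n + 1)).card ≤ (clusters K n).card * ((n + 1) * (2 * K)) := by
          refine Finset.card_biUnion_le_card_mul _ _ _ fun A hA => ?_
          refine Finset.card_image_le.trans ?_
          rw [Finset.card_product]
          refine Nat.mul_le_mul (card_le_of_mem_clusters hA) ?_
          simp
      _ ≤ K ^ 2 * (2 * K) ^ n * n.factorial * ((n + 1) * (2 * K)) := Nat.mul_le_mul_right _ ih
      _ = K ^ 2 * (2 * K) ^ (n + 1) * (n + 1).factorial := by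
          rw [Nat.factorial_succ]; ring

lemma IsTrap.exists_cluster {z : Game K} {τ : Finset (Profile K)} (h : IsTrap z τ) {n : ℕ}
    (hn : n < τ.card) : ∃ A ∈ clusters K n, A ⊆ τ ∧ A.card = n + 1 := by
  induction n with
  | zero =>
    obtain ⟨s, hs⟩ := Finset.card_pos.1 hn
    exact ⟨{s}, Finset.mem_image_of_mem _ (Finset.mem_univ _), by simpa using hs, by simp⟩
  | succ n ih =>
    obtain ⟨A, hA, hAτ, hcard⟩ := ih (by omega)
    obtain ⟨s, hs, i, t, ht, htA, hst⟩ := h.exists_neighbor hAτ (Finset.card_pos.1 (by omega))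
      (by omega)
    refine ⟨insert t A, ?_, Finset.insert_subset ht hAτ, ?_⟩
    · refine Finset.mem_biUnion.2 ⟨A, hA, Finset.mem_image.2 ⟨(s, i, t i), by simp [hs], ?_⟩⟩
      congr 1
      funext j
      rcases eq_or_ne j i with rfl | hj
      · simp
      · simp [hj, hst.2 j hj]
    · rw [Finset.card_insert_of_notMem htA, hcard]

end Clusters

/-! ### Summing over the shapes of large traps -/

section Binomials

lemma choose_two_le_choose {n m : ℕ} (h1 : 2 ≤ m) (h2 : m + 2 ≤ n) : n.choose 2 ≤ n.choose m := by
  induction n generalizing m with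
  | zero => omega
  | succ n ih =>
    rcases eq_or_ne m 2 with rfl | hm2
    · exact le_rfl
    rcases eq_or_ne (m + 2) (n + 1) with hm | hm
    · exact (Nat.choose_symm_of_eq_add hm.symm).ge
    obtain ⟨k, rfl⟩ : ∃ k, m = k + 1 := ⟨m - 1, by omega⟩
    rw [Nat.choose_succ_succ' n k, Nat.choose_succ_succ' n 1, Nat.choose_one_right]
    have h3 := ih (m := k + 1) h1 (by omega)
    rw [show 1 + 1 = 2 from rfl]
    have h4 : n ≤ n.choose k := by
      have h5 := ih (m := k) (by omega) (by omega)
      refine le_trans ?_ h5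
      rw [Nat.choose_two_right, Nat.le_div_iff_mul_le two_pos]
      exact Nat.mul_le_mul_left n (by omega)
    omega

lemma sum_inv_choose_le {K : ℕ} (hK : 2 ≤ K) :
    ∑ m ∈ Finset.range K, (if m = 0 then 0 else ((K.choose m : ℝ))⁻¹) ≤ 6 / K := by
  have hK' : (2 : ℝ) ≤ K := by exact_mod_cast hK
  -- The terms `m = 1` and `m = K - 1` are `1 / K`, the others of order `1 / K ^ 2`.
  have hterm : ∀ m ∈ Finset.range K, (if m = 0 then 0 else ((K.choose m : ℝ))⁻¹) ≤
      (if m = 1 then (K : ℝ)⁻¹ else 0) + (if m = K - 1 then (K : ℝ)⁻¹ else 0) + 4 / K ^ 2 := by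
    intro m hm
    rw [Finset.mem_range] at hm
    have hinv : (0 : ℝ) < (K : ℝ)⁻¹ := by positivity
    have h4 : (0 : ℝ) < 4 / K ^ 2 := by positivity
    rcases eq_or_ne m 0 with rfl | h0
    · simp only [if_true]
      positivity
    rcases eq_or_ne m 1 with rfl | h1
    · simp only [one_ne_zero, if_false, if_true, Nat.choose_one_right]
      split_ifs <;> linarith
    rcases eq_or_ne m (K - 1) with hm1 | hm1
    · have : K.choose m = K := by
        rw [hm1, Nat.choose_symm (by omega : 1 ≤ K), Nat.choose_one_right]
      simp only [h0, h1, if_false, if_pos hm1, this]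
      linarith
    · simp only [h0, h1, hm1, if_false, zero_add]
      have h5 := choose_two_le_choose (n := K) (m := m) (by omega) (by omega)
      have h6 : (K : ℝ) ^ 2 / 4 ≤ K.choose m := by
        refine le_trans ?_ (Nat.cast_le.2 h5)
        rw [Nat.cast_choose_two]
        nlinarith
      calc ((K.choose m : ℝ))⁻¹ ≤ ((K : ℝ) ^ 2 / 4)⁻¹ := inv_anti₀ (by positivity) h6
        _ = 4 / K ^ 2 := inv_div _ _
  refine (Finset.sum_le_sum hterm).trans ?_
  rw [Finset.sum_add_distrib, Finset.sum_add_distrib, Finset.sum_ite_eq', Finset.sum_ite_eq',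
    if_pos (Finset.mem_range.2 (by omega)), if_pos (Finset.mem_range.2 (by omega)),
    Finset.sum_const, Finset.card_range, nsmul_eq_mul]
  refine le_of_eq ?_
  field_simp
  norm_num

lemma choose_div_choose_le {r K m : ℕ} (hr : r ≤ K) (hm : m ≠ 0) (hmK : m ≤ K) :
    (r.choose m : ℝ) / K.choose m ≤ r / K := by
  rcases Nat.eq_zero_or_pos r with rfl | hr0
  · simp [Nat.choose_eq_zero_of_lt (Nat.pos_of_ne_zero hm)]
  have h := choose_div_choose_le_pow hr (by omega) m hmK
  refine h.trans ?_
  have hle : (r : ℝ) / K ≤ 1 := div_le_one_of_le₀ (by exact_mod_cast hr) (by positivity)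
  exact pow_le_of_le_one (by positivity) hle hm

/-- This fails for `D = univ`, whose term `S = univ` is `1`; here it matters that the presence of a
pure Nash equilibrium excludes a strategy of each player. -/
lemma sum_inv_choose_sq_le {K : ℕ} (D : Finset (Fin K)) (hD : D.Nonempty) (hDK : D.card < K) :
    ∑ S ∈ D.powerset.erase ∅, ((K.choose S.card : ℝ)⁻¹) ^ 2 ≤ 6 * D.card / K ^ 2 := by
  have hK : 2 ≤ K := by have := hD.card_pos; omega
  set f : ℕ → ℝ := fun m => if m = 0 then 0 else ((K.choose m : ℝ)⁻¹) ^ 2 with hf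
  have h1 : ∑ S ∈ D.powerset.erase ∅, ((K.choose S.card : ℝ)⁻¹) ^ 2 =
      ∑ S ∈ D.powerset, f S.card := by
    rw [← Finset.sum_erase (a := ∅) D.powerset (by simp [hf])]
    refine Finset.sum_congr rfl fun S hS => ?_
    have : S ≠ ∅ := (Finset.mem_erase.1 hS).1
    simp [hf, this]
  rw [h1, Finset.sum_powerset_apply_card]
  calc ∑ m ∈ Finset.range (D.card + 1), D.card.choose m • f m
      ≤ ∑ m ∈ Finset.range (D.card + 1),
          (D.card : ℝ) / K * (if m = 0 then 0 else ((K.choose m : ℝ))⁻¹) := by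
        refine Finset.sum_le_sum fun m hm => ?_
        rw [Finset.mem_range] at hm
        by_cases h0 : m = 0
        · simp [hf, h0]
        simp only [hf, h0, if_false, nsmul_eq_mul]
        rw [pow_two, ← mul_assoc]
        refine mul_le_mul_of_nonneg_right ?_ (by positivity)
        rw [← div_eq_mul_inv]
        exact choose_div_choose_le hDK.le h0 (by omega)
    _ ≤ ∑ m ∈ Finset.range K, (D.card : ℝ) / K * (if m = 0 then 0 else ((K.choose m : ℝ))⁻¹) := by
        refine Finset.sum_le_sum_of_subset_of_nonneg (Finset.range_mono hDK) fun m _ _ => ?_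
        split_ifs <;> positivity
    _ ≤ (D.card : ℝ) / K * (6 / K) := by
        rw [← Finset.mul_sum]
        gcongr
        exact sum_inv_choose_le hK
    _ = 6 * D.card / K ^ 2 := by ring

lemma sum_inv_choose_card (K : ℕ) :
    ∑ S : Finset (Fin K), ((K.choose S.card : ℝ))⁻¹ = K + 1 := by
  rw [← Finset.powerset_univ, Finset.sum_powerset_apply_card (fun m => ((K.choose m : ℝ))⁻¹)]
  rw [Finset.sum_congr rfl (g := fun _ => (1 : ℝ))]
  · simp
  · intro m hm
    rw [Finset.card_univ, Fintype.card_fin] at hm ⊢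
    rw [nsmul_eq_mul, mul_inv_cancel₀]
    have := Nat.choose_pos (Nat.lt_succ_iff.1 (Finset.mem_range.1 hm))
    positivity

lemma pow_mul_pow_le_pow_mul_pow (r c : ℕ) : r ^ c * c ^ r ≤ r ^ r * c ^ c := by
  wlog h : r ≤ c generalizing r c
  · have := this c r (by omega)
    linarith
  obtain ⟨d, rfl⟩ := Nat.exists_eq_add_of_le h
  rw [pow_add, pow_add (r + d) r d, mul_right_comm, ← mul_assoc, mul_assoc, mul_assoc]
  refine Nat.mul_le_mul_left _ ?_
  rw [mul_comm]
  exact (Nat.mul_le_mul_right _ (Nat.pow_le_pow_left h d)).trans_eq (mul_comm _ _)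

lemma six_pow_mul_self_pow_le (r : ℕ) :
    (6 : ℝ) ^ r * r ^ r / (r.factorial : ℝ) ^ 2 ≤
      Real.exp (12 * Real.exp 1) * (1 / 2) ^ r := by
  have h1 : (r : ℝ) ^ r / r.factorial ≤ Real.exp 1 ^ r := by
    rw [← Real.exp_nat_mul, mul_one]
    exact Real.pow_div_factorial_le_exp r (by positivity) r
  have h2 := Real.pow_div_factorial_le_exp (12 * Real.exp 1) (by positivity) r
  calc (6 : ℝ) ^ r * r ^ r / (r.factorial : ℝ) ^ 2
      = 6 ^ r / r.factorial * (r ^ r / r.factorial) := by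
        rw [div_mul_div_comm, pow_two]
    _ ≤ 6 ^ r / r.factorial * Real.exp 1 ^ r := by gcongr
    _ = (12 * Real.exp 1) ^ r / r.factorial * (1 / 2) ^ r := by
        rw [div_mul_eq_mul_div, div_mul_eq_mul_div, ← mul_pow, ← mul_pow]
        congr 2
        ring
    _ ≤ _ := by gcongr

/-- The expected number of candidate traps with `r` rows and `c` columns decays geometrically, even
after multiplication with the number of choices of the rows and columns. -/
lemma choose_sq_mul_pow_le {K : ℕ} (hK : 0 < K) (r c : ℕ) :
    ((K.choose r : ℝ) * K.choose c) ^ 2 * ((6 * r / K ^ 2) ^ c * (6 * c / K ^ 2) ^ r) ≤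
      Real.exp (12 * Real.exp 1) ^ 2 * (1 / 2) ^ (r + c) := by
  have hK' : (0 : ℝ) < K := by exact_mod_cast hK
  calc ((K.choose r : ℝ) * K.choose c) ^ 2 * ((6 * r / K ^ 2) ^ c * (6 * c / K ^ 2) ^ r)
      ≤ ((K : ℝ) ^ r / r.factorial * (K ^ c / c.factorial)) ^ 2 *
          ((6 * r / K ^ 2) ^ c * (6 * c / K ^ 2) ^ r) := by
        gcongr <;> exact Nat.choose_le_pow_div _ _
    _ = 6 ^ (r + c) * (r ^ c * c ^ r) / ((r.factorial : ℝ) ^ 2 * c.factorial ^ 2) := by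
        simp only [div_pow, mul_pow, ← pow_mul, pow_add, mul_comm 2]
        field_simp
    _ ≤ 6 ^ (r + c) * (r ^ r * c ^ c) / ((r.factorial : ℝ) ^ 2 * c.factorial ^ 2) := by
        refine div_le_div_of_nonneg_right (mul_le_mul_of_nonneg_left ?_ (by positivity))
          (by positivity)
        exact_mod_cast pow_mul_pow_le_pow_mul_pow r c
    _ = (6 ^ r * r ^ r / (r.factorial : ℝ) ^ 2) * (6 ^ c * c ^ c / (c.factorial : ℝ) ^ 2) := by
        rw [div_mul_div_comm]
        ring
    _ ≤ (Real.exp (12 * Real.exp 1) * (1 / 2) ^ r) * (Real.exp (12 * Real.exp 1) * (1 / 2) ^ c) := by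
        gcongr <;> exact six_pow_mul_self_pow_le _
    _ = _ := by ring

end Binomials

section Shapes

variable {K : ℕ}

/-- The squared probabilities that the lines of player `i` have prescribed top sets, summed over all
sets of profiles in which player `j` uses the strategies `D j`. The sum factorizes over the lines. -/
lemma sum_prod_inv_choose_sq_le (D : Fin 2 → Finset (Fin K)) (hD : ∀ i, (D i).Nonempty)
    (hDK : ∀ i, (D i).card < K) (i : Fin 2) :
    ∑ τ ∈ Finset.univ.filter (fun τ : Finset (Profile K) => shadow τ = D),
      (∏ y, ((K.choose (lineTrace τ (i, y)).card : ℝ))⁻¹) ^ 2 ≤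
      (6 * (D i).card / K ^ 2) ^ (D i.rev).card := by
  classical
  set F : Finset (Profile K) → Fin K → Finset (Fin K) := fun τ y => lineTrace τ (i, y) with hF
  set T : Fin K → Finset (Finset (Fin K)) := fun y =>
    if y ∈ D i.rev then (D i).powerset.erase ∅ else {∅} with hT
  set g : Finset (Fin K) → ℝ := fun S => ((K.choose S.card : ℝ)⁻¹) ^ 2 with hg
  calc ∑ τ ∈ Finset.univ.filter (fun τ : Finset (Profile K) => shadow τ = D),
        (∏ y, ((K.choose (lineTrace τ (i, y)).card : ℝ))⁻¹) ^ 2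
      = ∑ p ∈ (Finset.univ.filter (fun τ : Finset (Profile K) => shadow τ = D)).image F,
          ∏ y, g (p y) := by
        rw [Finset.sum_image (lineTrace_injective i).injOn]
        exact Finset.sum_congr rfl fun τ _ => (Finset.prod_pow _ _ _).symm
    _ ≤ ∑ p ∈ Fintype.piFinset T, ∏ y, g (p y) := by
        refine Finset.sum_le_sum_of_subset_of_nonneg ?_ fun p _ _ =>
          Finset.prod_nonneg fun y _ => by positivity
        intro p hp
        obtain ⟨τ, hτ, rfl⟩ := Finset.mem_image.1 hp
        have hτ' : shadow τ = D := (Finset.mem_filter.1 hτ).2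
        rw [Fintype.mem_piFinset]
        intro y
        simp only [hT, hF, ← hτ', ← lineTrace_nonempty_iff]
        split_ifs with hne
        · exact Finset.mem_erase.2 ⟨hne.ne_empty,
            Finset.mem_powerset.2 (lineTrace_subset_shadow τ i y)⟩
        · simpa [Finset.not_nonempty_iff_eq_empty] using hne
    _ = ∏ y, ∑ S ∈ T y, g S := (Finset.prod_univ_sum _ _).symm
    _ = ∏ y ∈ D i.rev, ∑ S ∈ (D i).powerset.erase ∅, g S := by
        rw [← Finset.prod_subset (Finset.subset_univ (D i.rev))]
        · exact Finset.prod_congr rfl fun y hy => by simp only [hT, if_pos hy]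
        · intro y _ hy
          simp [hT, hy, hg]
    _ ≤ (6 * (D i).card / K ^ 2) ^ (D i.rev).card := by
        rw [Finset.prod_const]
        refine pow_le_pow_left₀ (Finset.sum_nonneg fun S _ => ?_) ?_ _
        · positivity
        · exact sum_inv_choose_sq_le (D i) (hD i) (hDK i)

/-- Cauchy-Schwarz separates the two players: the traces on the lines of one player already
determine the set of profiles. -/
lemma sum_prod_inv_choose_le (hK : 0 < K) (D : Fin 2 → Finset (Fin K))
    (hD : ∀ i, (D i).Nonempty) (hDK : ∀ i, (D i).card < K) :
    ∑ τ ∈ Finset.univ.filter (fun τ : Finset (Profile K) => shadow τ = D),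
      ∏ ℓ, ((K.choose (lineTrace τ ℓ).card : ℝ))⁻¹ ≤
      Real.exp (12 * Real.exp 1) * √(1 / 2) ^ ((D 0).card + (D 1).card) *
        ∏ i, ((K.choose (D i).card : ℝ))⁻¹ := by
  have hch : ∀ i, (0 : ℝ) < K.choose (D i).card := fun i => by
    exact_mod_cast Nat.choose_pos (hDK i).le
  refine le_of_sq_le_sq ?_ (by positivity)
  simp only [Fintype.prod_prod_type, Fin.prod_univ_two]
  refine (Finset.sum_mul_sq_le_sq_mul_sq _ _ _).trans ?_
  have h0 := sum_prod_inv_choose_sq_le D hD hDK 0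
  have h1 := sum_prod_inv_choose_sq_le D hD hDK 1
  have h := choose_sq_mul_pow_le hK (D 0).card (D 1).card
  calc _ ≤ (6 * (D 0).card / (K : ℝ) ^ 2) ^ (D 1).card * (6 * (D 1).card / K ^ 2) ^ (D 0).card := by
        gcongr
        · exact h0
        · exact h1
    _ ≤ Real.exp (12 * Real.exp 1) ^ 2 * (1 / 2) ^ ((D 0).card + (D 1).card) /
          ((K.choose (D 0).card : ℝ) * K.choose (D 1).card) ^ 2 := by
        rw [le_div_iff₀ (by have := hch 0; have := hch 1; positivity), mul_comm]
        exact h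
    _ = _ := by
        have hs : (√(1 / 2 : ℝ) ^ ((D 0).card + (D 1).card)) ^ 2 =
            (1 / 2) ^ ((D 0).card + (D 1).card) := by
          rw [← pow_mul, mul_comm, pow_mul, Real.sq_sqrt (by norm_num)]
        rw [mul_pow (_ * _ ^ _), mul_pow _ (_ ^ _), hs, ← mul_inv, inv_pow, div_eq_mul_inv]

/-- The expected number of sets of profiles that are closed under better responses, miss a strategy
of each player, and use at least `M` strategies altogether is exponentially small in `M`. -/
lemma sum_large_shapes_le (hK : 0 < K) (M : ℕ) :
    ∑ τ ∈ Finset.univ.filter (fun τ : Finset (Profile K) => (∀ i, (shadow τ i).Nonempty) ∧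
        (∀ i, (shadow τ i).card < K) ∧ M ≤ (shadow τ 0).card + (shadow τ 1).card),
      ∏ ℓ, ((K.choose (lineTrace τ ℓ).card : ℝ))⁻¹ ≤
      Real.exp (12 * Real.exp 1) * √(1 / 2) ^ M * (K + 1) ^ 2 := by
  classical
  rw [← Finset.sum_fiberwise_of_maps_to (g := shadow) (t := (Finset.univ :
    Finset (Fin 2 → Finset (Fin K)))) (by simp)]
  rw [← sum_inv_choose_card K, Fintype.sum_pow, Finset.mul_sum]
  refine Finset.sum_le_sum fun D _ => ?_
  by_cases hD : (∀ i, (D i).Nonempty) ∧ (∀ i, (D i).card < K) ∧ M ≤ (D 0).card + (D 1).card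
  · refine le_trans (le_of_eq ?_) ((sum_prod_inv_choose_le hK D hD.1 hD.2.1).trans ?_)
    · refine Finset.sum_congr ?_ fun _ _ => rfl
      ext τ
      simp only [Finset.mem_filter, Finset.mem_univ, true_and, and_iff_right_iff_imp]
      rintro rfl
      exact hD
    · have hs : √(1 / 2 : ℝ) ≤ 1 := by
        rw [Real.sqrt_le_one]; norm_num
      have := pow_le_pow_of_le_one (Real.sqrt_nonneg _) hs hD.2.2
      gcongr
  · rw [Finset.sum_eq_zero]
    · positivity
    · intro τ hτ
      simp only [Finset.mem_filter, Finset.mem_univ, true_and] at hτ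
      obtain ⟨h, rfl⟩ := hτ
      exact absurd h hD

end Shapes

/-! ### The probability of a trap next to an equilibrium -/

section Probability

variable {K : ℕ} {Ω : Type*} [MeasurableSpace Ω] {P : Measure Ω} [IsProbabilityMeasure P]
  {ν : Measure ℝ} [IsProbabilityMeasure ν] {Z : Fin 2 → Profile K → Ω → ℝ}

lemma linePoint_injective : Function.Injective fun p : (Fin 2 × Fin K) × Fin K =>
    (p.1.1, linePoint p.1.1 p.1.2 p.2) := by
  rintro ⟨⟨i, y⟩, x⟩ ⟨⟨i', y'⟩, x'⟩ h
  obtain ⟨rfl, h⟩ := Prod.mk.inj h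
  have h1 := congrFun h i
  have h2 := congrFun h i.rev
  simp only [linePoint_self, linePoint_rev] at h1 h2
  rw [h1, h2]

/-- The payoffs on different lines are independent, and i.i.d. on each line. -/
lemma measureReal_forall_line (hZ : ∀ i s, Measurable (Z i s)) (hlaw : ∀ i s, P.map (Z i s) = ν)
    (hind : iIndepFun (fun p : Fin 2 × Profile K => Z p.1 p.2) P)
    (U : Fin 2 × Fin K → Set (Fin K → ℝ)) (hU : ∀ ℓ, MeasurableSet (U ℓ)) :
    P.real {ω | ∀ ℓ : Fin 2 × Fin K, (fun x => Z ℓ.1 (linePoint ℓ.1 ℓ.2 x) ω) ∈ U ℓ} =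
      ∏ ℓ, (Measure.pi fun _ : Fin K => ν).real (U ℓ) :=
  measureReal_forall_row ν (fun ℓ x => Z ℓ.1 (linePoint ℓ.1 ℓ.2 x)) (fun _ _ => hZ _ _)
    (fun _ _ => hlaw _ _) (hind.precomp linePoint_injective) U hU

/-- It is exponentially unlikely in `M` that the game has a set of profiles which is closed under
better responses, misses a strategy of each player, and uses at least `M` strategies altogether. -/
lemma measureReal_large_le (hK : 0 < K) (hZ : ∀ i s, Measurable (Z i s))
    (hlaw : ∀ i s, P.map (Z i s) = ν)
    (hind : iIndepFun (fun p : Fin 2 × Profile K => Z p.1 p.2) P) (M : ℕ) :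
    P.real {ω | ∃ τ : Finset (Profile K), ((∀ i, (shadow τ i).Nonempty) ∧
        (∀ i, (shadow τ i).card < K) ∧ M ≤ (shadow τ 0).card + (shadow τ 1).card) ∧
        ∀ ℓ : Fin 2 × Fin K,
          (fun x => Z ℓ.1 (linePoint ℓ.1 ℓ.2 x) ω) ∈ topSet (lineTrace τ ℓ)} ≤
      Real.exp (12 * Real.exp 1) * √(1 / 2) ^ M * (K + 1) ^ 2 := by
  classical
  refine le_trans ?_ (sum_large_shapes_le hK M)
  refine le_trans ?_ (Finset.sum_le_sum fun τ _ => (measureReal_forall_line hZ hlaw hind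
    (fun ℓ => topSet (lineTrace τ ℓ)) fun ℓ => measurableSet_topSet _).trans_le
      (Finset.prod_le_prod (fun _ _ => measureReal_nonneg) fun ℓ _ => ?_))
  · refine le_trans (measureReal_mono ?_ (measure_ne_top _ _)) (measureReal_biUnion_finset_le _ _)
    rintro ω ⟨τ, hτ, hω⟩
    simp only [Set.mem_iUnion]
    exact ⟨τ, by simpa using hτ, hω⟩
  · simpa using measureReal_topSet_le ν (lineTrace τ ℓ)

/-- The probability that some cluster of `n + 1` profiles consists of profiles among the `L` best
on both of their lines: there are of the order of `K ^ (n + 2)` clusters, and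
each of them has to satisfy `2 (n + 1)` conditions of probability at most `L / K`. -/
lemma measureReal_small_le (hK : 0 < K) (hZ : ∀ i s, Measurable (Z i s))
    (hlaw : ∀ i s, P.map (Z i s) = ν)
    (hind : iIndepFun (fun p : Fin 2 × Profile K => Z p.1 p.2) P) {L : ℕ} (hL : L ≤ K) (n : ℕ) :
    P.real {ω | ∃ A ∈ clusters K n, A.card = n + 1 ∧ ∀ ℓ : Fin 2 × Fin K,
          (fun x => Z ℓ.1 (linePoint ℓ.1 ℓ.2 x) ω) ∈ topRank L (lineTrace A ℓ)} ≤
      (K ^ 2 * (2 * K) ^ n * n.factorial) * ((L : ℝ) / K) ^ (2 * (n + 1)) := by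
  classical
  calc _ ≤ P.real (⋃ A ∈ (clusters K n).filter fun A => A.card = n + 1,
        {ω | ∀ ℓ : Fin 2 × Fin K,
          (fun x => Z ℓ.1 (linePoint ℓ.1 ℓ.2 x) ω) ∈ topRank L (lineTrace A ℓ)}) := by
        refine measureReal_mono ?_ (measure_ne_top _ _)
        rintro ω ⟨A, hA, hcard, hω⟩
        simp only [Set.mem_iUnion]
        exact ⟨A, Finset.mem_filter.2 ⟨hA, hcard⟩, hω⟩
    _ ≤ ∑ A ∈ (clusters K n).filter fun A => A.card = n + 1, ((L : ℝ) / K) ^ (2 * (n + 1)) := by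
        refine (measureReal_biUnion_finset_le _ _).trans (Finset.sum_le_sum fun A hA => ?_)
        rw [measureReal_forall_line hZ hlaw hind (fun ℓ => topRank L (lineTrace A ℓ))
          fun ℓ => measurableSet_topRank _ _]
        calc _ ≤ ∏ ℓ : Fin 2 × Fin K, ((L : ℝ) / K) ^ (lineTrace A ℓ).card := by
              refine Finset.prod_le_prod (fun _ _ => measureReal_nonneg) fun ℓ _ => ?_
              simpa using measureReal_topRank_le ν (by simpa using hL) (by simpa using hK)
                (lineTrace A ℓ)
          _ = _ := by
              rw [Finset.prod_pow_eq_pow_sum, Fintype.sum_prod_type]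
              simp [sum_card_lineTrace, (Finset.mem_filter.1 hA).2]
    _ ≤ _ := by
        rw [Finset.sum_const, nsmul_eq_mul]
        gcongr
        exact_mod_cast (Finset.card_filter_le _ _).trans (card_clusters_le K n)

lemma ae_forall_ne (hν : ∀ x, ν {x} = 0) (hZ : ∀ i s, Measurable (Z i s))
    (hlaw : ∀ i s, P.map (Z i s) = ν)
    (hind : iIndepFun (fun p : Fin 2 × Profile K => Z p.1 p.2) P) :
    ∀ᵐ ω ∂P, ∀ i s t, s ≠ t → Z i s ω ≠ Z i t ω := by
  simp only [ae_all_iff]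
  intro i s t hst
  exact ae_ne_of_indepFun hν (hZ i s) (hZ i t) (hlaw i s) (hlaw i t)
    (hind.indepFun (i := (i, s)) (j := (i, t)) fun h => hst (Prod.mk.inj h).2)

/-- A trap that coexists with a pure Nash equilibrium is either large, or contains a cluster of
four profiles that rank among the `L` best on each line. -/
lemma exists_large_or_cluster {z : Game K} (hz : ∀ i s t, s ≠ t → z i s ≠ z i t)
    (hτ : (traps z).Nonempty) (he : (pneSet z).Nonempty) (L : ℕ) :
    (∃ τ : Finset (Profile K), ((∀ i, (shadow τ i).Nonempty) ∧
        (∀ i, (shadow τ i).card < K) ∧ L + 1 ≤ (shadow τ 0).card + (shadow τ 1).card) ∧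
        ∀ ℓ : Fin 2 × Fin K,
          (fun x => z ℓ.1 (linePoint ℓ.1 ℓ.2 x)) ∈ topSet (lineTrace τ ℓ)) ∨
    ∃ A ∈ clusters K 3, A.card = 3 + 1 ∧ ∀ ℓ : Fin 2 × Fin K,
          (fun x => z ℓ.1 (linePoint ℓ.1 ℓ.2 x)) ∈ topRank L (lineTrace A ℓ) := by
  obtain ⟨τ, hτ⟩ := hτ
  obtain ⟨e, he⟩ := he
  simp only [traps, trapsOfLength, Set.mem_iUnion, Set.mem_ofPred_eq] at hτ
  obtain ⟨n, hn, hτ, rfl⟩ := hτ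
  by_cases hL : ∀ i, (shadow τ i).card ≤ L
  · right
    obtain ⟨A, hA, hAτ, hcard⟩ := hτ.exists_cluster (n := 3) hn.1
    exact ⟨A, hA, hcard, hτ.mem_topRank hL hAτ⟩
  · left
    refine ⟨τ, ⟨fun i => ?_, hτ.card_shadow_lt hz he, ?_⟩, hτ.mem_topSet⟩
    · exact (Finset.card_pos.1 (by have := hτ.1; omega)).image _
    · push Not at hL
      obtain ⟨i, hi⟩ := hL
      fin_cases i <;> simp at hi <;> omega

end Probability

section Asymptotics

open Filter Topology

/-- The exponential decay in the size of the large sets beats every power of `K`. -/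
lemma eventually_exp_small {α : ℝ} (hα : 0 < α) (B : ℝ) (hB : 0 < B) :
    ∀ᶠ K : ℕ in atTop, ∀ M : ℕ, (K : ℝ) ^ (α / 4) ≤ M →
      B * √(1 / 2) ^ M * ((K : ℝ) + 1) ^ 2 ≤ (K : ℝ) ^ (-3 : ℝ) := by
  have hq0 : 0 < √(1 / 2 : ℝ) := by positivity
  have hq1 : √(1 / 2 : ℝ) < 1 := by
    rw [Real.sqrt_lt' one_pos]; norm_num
  have hb : 0 < -Real.log √(1 / 2 : ℝ) := neg_pos.2 (Real.log_neg hq0 hq1)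
  have hlim := (tendsto_rpow_mul_exp_neg_mul_atTop_nhds_zero (20 / α) _ hb).comp
    ((tendsto_rpow_atTop (by positivity : 0 < α / 4)).comp tendsto_natCast_atTop_atTop)
  have hev := hlim.eventually_le_const (u := 1 / (4 * B)) (by positivity)
  filter_upwards [hev, eventually_ge_atTop 1] with K h hK M hM
  have hK' : (1 : ℝ) ≤ K := by exact_mod_cast hK
  -- The exponent `20 / α` turns the power of `K ^ (α / 4)` into `K ^ 5`.
  have h5 : ((K : ℝ) ^ (α / 4)) ^ (20 / α) = (K : ℝ) ^ 5 := by
    rw [← Real.rpow_mul (by positivity), ← Real.rpow_natCast]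
    congr 1
    field_simp
    norm_num
  have hqM : √(1 / 2 : ℝ) ^ M ≤ Real.exp (- -Real.log √(1 / 2 : ℝ) * (K : ℝ) ^ (α / 4)) := by
    rw [neg_neg, ← Real.rpow_def_of_pos hq0, ← Real.rpow_natCast]
    exact Real.rpow_le_rpow_of_exponent_ge hq0 hq1.le hM
  simp only [Function.comp_apply, h5] at h
  rw [le_div_iff₀ (by positivity)] at h
  have h3 : (K : ℝ) ^ (-3 : ℝ) = 1 / (K : ℝ) ^ 3 := by
    rw [Real.rpow_neg (by positivity), one_div]
    norm_cast
  rw [h3, le_div_iff₀ (by positivity)]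
  set E := Real.exp (- -Real.log √(1 / 2 : ℝ) * (K : ℝ) ^ (α / 4))
  calc B * √(1 / 2) ^ M * ((K : ℝ) + 1) ^ 2 * K ^ 3
      ≤ B * E * ((K : ℝ) + K) ^ 2 * K ^ 3 := by gcongr
    _ = (K : ℝ) ^ 5 * E * (4 * B) := by ring
    _ ≤ 1 := h

lemma cluster_bound_le {α : ℝ} {K L : ℕ} (hK : 0 < K) (hL : (L : ℝ) ≤ (K : ℝ) ^ (α / 4)) :
    ((K : ℝ) ^ 2 * (2 * K) ^ 3 * (Nat.factorial 3 : ℕ)) * ((L : ℝ) / K) ^ (2 * (3 + 1)) ≤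
      48 * (K : ℝ) ^ (-3 + 2 * α) := by
  have hK' : (0 : ℝ) < K := by exact_mod_cast hK
  have h1 : (L : ℝ) ^ 8 ≤ (K : ℝ) ^ (2 * α) := by
    calc (L : ℝ) ^ 8 ≤ ((K : ℝ) ^ (α / 4)) ^ 8 := by gcongr
      _ = (K : ℝ) ^ (2 * α) := by
        rw [← Real.rpow_natCast, ← Real.rpow_mul hK'.le]
        congr 1
        push_cast
        ring
  have h3 : (K : ℝ) ^ (-3 : ℝ) = 1 / (K : ℝ) ^ 3 := by
    rw [Real.rpow_neg hK'.le, one_div]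
    norm_cast
  rw [Real.rpow_add hK', h3]
  calc _ = 48 * (1 / (K : ℝ) ^ 3 * (L : ℝ) ^ 8) := by
        rw [div_pow, show ((Nat.factorial 3 : ℕ) : ℝ) = 6 by norm_num [Nat.factorial]]
        field_simp
        ring
    _ ≤ _ := by gcongr

end Asymptotics

end RandomGame


theorem theorem2 (α : ℝ) (hα0 : 0 < α) (hα1 : α < 1) :
    ∃ C : ℝ, 0 < C ∧ ∃ K₀ : ℕ, ∀ K : ℕ, K₀ ≤ K →
      ∀ (Ω : Type*) [MeasurableSpace Ω] (P : MeasureTheory.Measure Ω)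
        [MeasureTheory.IsProbabilityMeasure P]
        (ν : MeasureTheory.Measure ℝ)
        (Z : Fin 2 → RandomGame.Profile K → Ω → ℝ),
        (∀ x : ℝ, ν {x} = 0) →
        (∀ i s, Measurable (Z i s)) →
        (∀ i s, P.map (Z i s) = ν) →
        ProbabilityTheory.iIndepFun
          (fun p : Fin 2 × RandomGame.Profile K => Z p.1 p.2) P →
        P.real {ω | (RandomGame.traps fun i s => Z i s ω).Nonempty ∧
            (RandomGame.pneSet fun i s => Z i s ω).Nonempty} ≤
          C * (K : ℝ) ^ (-3 + 2 * α) + (K : ℝ) ^ 2 * (1 / 2 : ℝ) ^ ((K : ℝ) ^ (α / 2)) +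
            (K : ℝ) ^ (-((K : ℝ) ^ α)) := by
  obtain ⟨K₁, hK₁⟩ := Filter.eventually_atTop.1
    (RandomGame.eventually_exp_small hα0 (Real.exp (12 * Real.exp 1)) (Real.exp_pos _))
  -- The clusters account for `48`, the large sets for `1`; ties have probability zero.
  refine ⟨49, by norm_num, max K₁ 1, fun K hK Ω _ P _ ν Z hν hZ hlaw hind => ?_⟩
  have hK1 : 1 ≤ K := (le_max_right _ _).trans hK
  have hKr : (1 : ℝ) ≤ K := by exact_mod_cast hK1
  have hprob : IsProbabilityMeasure ν :=
    hlaw 0 (fun _ => ⟨0, hK1⟩) ▸ Measure.isProbabilityMeasure_map (hZ _ _).aemeasurable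
  set L := ⌊(K : ℝ) ^ (α / 4)⌋₊ with hLdef
  have hL : (L : ℝ) ≤ (K : ℝ) ^ (α / 4) := Nat.floor_le (by positivity)
  have hLK : L ≤ K := by
    have : (K : ℝ) ^ (α / 4) ≤ (K : ℝ) ^ (1 : ℝ) :=
      Real.rpow_le_rpow_of_exponent_le hKr (by linarith)
    rw [Real.rpow_one] at this
    exact_mod_cast hL.trans this
  have hM : (K : ℝ) ^ (α / 4) ≤ (L + 1 : ℕ) := by
    push_cast
    exact (Nat.lt_floor_add_one _).le
  have hlarge := (RandomGame.measureReal_large_le hK1 hZ hlaw hind (L + 1)).trans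
    (hK₁ K ((le_max_left _ _).trans hK) _ hM)
  have hsmall := (RandomGame.measureReal_small_le hK1 hZ hlaw hind hLK 3).trans
    (RandomGame.cluster_bound_le hK1 hL)
  have hties := (measureReal_eq_zero_iff).2
    (ae_iff.1 (RandomGame.ae_forall_ne hν hZ hlaw hind))
  have hpow : (K : ℝ) ^ (-3 : ℝ) ≤ (K : ℝ) ^ (-3 + 2 * α) :=
    Real.rpow_le_rpow_of_exponent_le hKr (by linarith)
  have h0 : 0 ≤ (K : ℝ) ^ 2 * (1 / 2 : ℝ) ^ ((K : ℝ) ^ (α / 2)) := by positivity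
  have h0' : 0 ≤ (K : ℝ) ^ (-((K : ℝ) ^ α)) := by positivity
  refine (measureReal_mono (fun ω hω => ?_)).trans ((measureReal_union_le _ _).trans
    ((add_le_add ((measureReal_union_le _ _).trans (add_le_add hlarge hsmall)) hties.le).trans ?_))
  · by_cases hz : ∀ i s t, s ≠ t → Z i s ω ≠ Z i t ω
    · exact Or.inl (RandomGame.exists_large_or_cluster (z := fun i s => Z i s ω) hz hω.1 hω.2 L)
    · exact Or.inr hz
  · linarith
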